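/- Let $(\Omega,\mathcal F,\mathbb P)$ be a complete probability space, $E$ a separable (real) Banach space with Borel $\sigma$-algebra $\mathcal B(E)$ and dual $E^*$, and let $p\in\{0\}\cup[1,\infty)$. Let $L^0(E)$ be the space of $E$-valued random variables modulo almost sure equality, with the topology of convergence in probability, and for $p\ge 1$ let $L^p(E)$ be the space of those with $\mathbb E|\xi|^p<\infty$, with its norm topology; $\operatorname{cl}_p$ denotes closure in $L^p(E)$. A *random set* is a map $X\colon\Omega\to\mathcal P(E)$ whose graph $\{(\omega,x)\colon x\in X(\omega)\}$ belongs to $\mathcal F\otimes\mathcal B(E)$; it is *closed*, *convex*, *nonempty* if $X(\omega)$ is so for almost every $\omega$. $L^p(X)$ denotes the set of all $\xi\in L^p(E)$ with $\xi(\omega)\in X(\omega)$ for almost every $\omega$ with $X(\omega)\neq\emptyset$. A set $D\subseteq L^p(E)$ is *decomposable* if $1_B\xi+1_{B^c}\zeta\in D$ for all $\xi,\zeta\in D$, $B\in\mathcal F$, and $\operatorname{dec}A$ is the smallest decomposable set containing $A$. For $\emptyset\ne A\subseteq L^p(E)$, let $F_A$ be the almost surely unique nonempty closed random set with $\operatorname{cl}_p\operatorname{dec}A=L^p(F_A)$.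 A transition probability kernel $K$ from $(\Omega,\mathcal F)$ to $(E,\mathcal B(E))$ has *barycenter* $Y\in L^p(E)$ if, for almost every $\omega$, every $L\in E^*$ is $K(\omega,\cdot)$-integrable and $L(Y(\omega))=\int_E L(x)\,K(\omega,dx)$. The set $A$ is *$p$-Choquet convex decomposable* if it contains the barycenter of every transition probability kernel $K$ that has a barycenter in $L^p(E)$ and satisfies $K(\omega,F_A(\omega))=1$ for almost every $\omega$. **Proposition.** Let $A$ be a nonempty subset of $L^p(E)$. Then $A$ is $p$-Choquet convex decomposable if and only if $A=L^p(X)$ for some closed convex random set $X$ in $E$. In this case $X$ can be chosen nonempty, and among nonempty closed convex random sets it is then unique up to almost sure equality. -/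

import Mathlib

open MeasureTheory ProbabilityTheory Filter Topology
open scoped ENNReal

namespace RandomSets

variable {Ω E : Type*} [MeasurableSpace Ω]

/-! ### Random sets -/

/-- A multifunction `X : Ω → 𝒫(E)` is a random set (graph measurable) if its graph
belongs to the product sigma-algebra. -/
def IsRandomSet [MeasurableSpace E] (X : Ω → Set E) : Prop :=
  MeasurableSet {q : Ω × E | q.2 ∈ X q.1}

/-- A closed random set: graph measurable, with almost surely closed values. -/
def IsClosedRandomSet [MeasurableSpace E] [TopologicalSpace E] (μ : Measure Ω)
    (X : Ω → Set E) : Prop :=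
  IsRandomSet X ∧ ∀ᵐ ω ∂μ, IsClosed (X ω)

/-- A closed convex random set: graph measurable, with almost surely closed and convex values. -/
def IsClosedConvexRandomSet [MeasurableSpace E] [NormedAddCommGroup E] [NormedSpace ℝ E]
    (μ : Measure Ω) (X : Ω → Set E) : Prop :=
  IsClosedRandomSet μ X ∧ ∀ᵐ ω ∂μ, Convex ℝ (X ω)

/-- A multifunction with almost surely nonempty values. -/
def IsNonemptyValued (μ : Measure Ω) (X : Ω → Set E) : Prop :=
  ∀ᵐ ω ∂μ, (X ω).Nonempty

/-! ### The spaces `L^p(E)` for `p ∈ {0} ∪ [1, ∞)`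

Mathlib's `Lp E p μ` is used as a set of almost sure equivalence classes. Since `eLpNorm f 0 μ = 0`
for every `f`, the type `Lp E 0 μ` consists of all classes of random variables, that is, it
is `L^0(E)`. -/

variable [NormedAddCommGroup E] {p : ℝ≥0∞} {μ : Measure Ω}

/-- `L^p(X)`: the classes in `L^p(E)` of selections of `X`, that is, of random variables `ξ` with
`ξ(ω) ∈ X(ω)` for almost every `ω` in the domain `{ω | X(ω) ≠ ∅}` of `X`. -/
def selections (p : ℝ≥0∞) (μ : Measure Ω) (X : Ω → Set E) : Set (Lp E p μ) :=
  {ξ | ∀ᵐ ω ∂μ, (X ω).Nonempty → ξ ω ∈ X ω}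

/-- `A` is decomposable: `1_B ξ + 1_{Bᶜ} ζ ∈ A` for all `ξ, ζ ∈ A` and all events `B`. -/
def IsDecomposable (A : Set (Lp E p μ)) : Prop :=
  ∀ ξ ∈ A, ∀ ζ ∈ A, ∀ B : Set Ω, MeasurableSet B → ∀ η : Lp E p μ,
    (∀ᵐ ω ∂μ, η ω = B.indicator (fun ω => ξ ω) ω + Bᶜ.indicator (fun ω => ζ ω) ω) → η ∈ A

/-- The decomposable hull: the intersection of all decomposable sets containing `A`. -/
def decHull (A : Set (Lp E p μ)) : Set (Lp E p μ) :=
  ⋂₀ {D | IsDecomposable D ∧ A ⊆ D}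

/-- Strong convergence of sequences in `L^p(E)`: convergence in probability if `p = 0`,
convergence in the `L^p` norm otherwise. -/
def TendstoLp (u : ℕ → Lp E p μ) (ξ : Lp E p μ) : Prop :=
  if p = 0 then TendstoInMeasure μ (fun n ω => u n ω) atTop (fun ω => ξ ω)
  else Tendsto (fun n => eLpNorm (fun ω => u n ω - ξ ω) p μ) atTop (𝓝 0)

/-- The strong closure `cl_p A` of `A` in `L^p(E)`. Both topologies are metrizable, so the closure
consists of the limits of sequences in `A`. -/
def strongClosure (A : Set (Lp E p μ)) : Set (Lp E p μ) :=
  {ξ | ∃ u : ℕ → Lp E p μ, (∀ n, u n ∈ A) ∧ TendstoLp u ξ}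

/-- `F` is (a version of) the almost surely unique nonempty-valued closed random set `F_A`
determined by `cl_p dec A = L^p(F_A)`. -/
def IsDecHullRandomSet [MeasurableSpace E] (A : Set (Lp E p μ)) (F : Ω → Set E) : Prop :=
  IsClosedRandomSet μ F ∧ IsNonemptyValued μ F ∧ strongClosure (decHull A) = selections p μ F

/-! ### Barycenters of transition kernels -/

variable [NormedSpace ℝ E] [MeasurableSpace E]

/-- `y` is the barycenter of the measure `ν` on `E`: every continuous linear functional `L`
is `ν`-integrable and `L y = ∫ L(x) ν(dx)`. -/
def IsBarycenter (ν : Measure E) (y : E) : Prop :=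
  ∀ L : E →L[ℝ] ℝ, Integrable (fun x => L x) ν ∧ L y = ∫ x, L x ∂ν

/-- `Y ∈ L^p(E)` is the barycenter of the transition kernel `K`: for almost every `ω`,
`L (Y ω) = ∫ L(x) K(ω, dx)` for every continuous linear functional `L`. -/
def IsKernelBarycenter (K : Kernel Ω E) (Y : Lp E p μ) : Prop :=
  ∀ᵐ ω ∂μ, IsBarycenter (K ω) (Y ω)

/-- `Y` is a `p`-Choquet convex decomposition of points in `A`: the barycenter in `L^p(E)` of a
transition probability kernel `K` with `K(ω, F_A(ω)) = 1` for almost every `ω`. -/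
def IsChoquetConvexDecomposition (A : Set (Lp E p μ)) (Y : Lp E p μ) : Prop :=
  ∃ F : Ω → Set E, IsDecHullRandomSet A F ∧
    ∃ K : Kernel Ω E, IsMarkovKernel K ∧ (∀ᵐ ω ∂μ, K ω (F ω) = 1) ∧ IsKernelBarycenter K Y

/-- `A` is `p`-Choquet convex decomposable: it contains all `p`-Choquet convex decompositions
of its points. -/
def IsChoquetConvexDecomposable (A : Set (Lp E p μ)) : Prop :=
  ∀ Y : Lp E p μ, IsChoquetConvexDecomposition A Y → Y ∈ A

end RandomSets

namespace RandomSets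

/-! ### Analytic sets are universally measurable -/

/-! If `A = L^p(X)`, then `A` is decomposable, and passing to almost surely convergent subsequences
shows that it is strongly closed, so `L^p(F_A) ⊆ L^p(X)`. By `ae_subset_of_selections_subset`, `F_A
⊆ X` almost surely where `X ≠ ∅`. A kernel carried by `F_A` is thus carried there by the closed
convex set `X(ω)`, and Hahn-Banach puts its barycenter in it.

Conversely, `cl_p dec A` is the set of selections of `F(ω) = closure {u n ω}` for a sequence `u n`
in `dec A`. Kernels with two atoms at selections of `F` give `(1 - t) ξ + t ζ ∈ A`. The weight `t =
0` yields `A = L^p(F)`, and countably many weights applied to all pairs `u k`, `u l` make `F` almost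
surely convex.

Uniqueness is the comparison of selections in both directions. That comparison needs measurable
selections, hence measurable projections: analytic sets are universally measurable and `μ` is
complete. -/

theorem exists_prefix_subset_of_isOpen (N : ℕ → ℕ) {V : Set (ℕ → ℕ)} (hV : IsOpen V)
    (hNV : {σ : ℕ → ℕ | ∀ i, σ i ≤ N i} ⊆ V) :
    ∃ k, {σ : ℕ → ℕ | ∀ i < k, σ i ≤ N i} ⊆ V := by
  by_contra! h
  have h' : ∀ k, ∃ σ : ℕ → ℕ, (∀ i < k, σ i ≤ N i) ∧ σ ∉ V := fun k =>
    Set.not_subset.1 (h k)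
  choose σ hσN hσV using h'
  have hK : IsCompact {σ : ℕ → ℕ | ∀ i, σ i ≤ N i} := by
    have := isCompact_univ_pi (fun i : ℕ => (Set.finite_Iic (N i)).isCompact)
    convert this using 1
    ext; simp [Pi.le_def]
  obtain ⟨τ, hτ, φ, hφ, hlim⟩ := hK.tendsto_subseq
    (x := fun k i => min (σ k i) (N i)) (fun k i => min_le_right _ _)
  -- Clamping leaves coordinate `i` unchanged once `φ k > i`, so the unclamped points have the same
  -- limit.
  have hlim' : Tendsto (σ ∘ φ) atTop (𝓝 τ) := by
    rw [tendsto_pi_nhds] at hlim ⊢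
    intro i
    refine (hlim i).congr' ?_
    filter_upwards [eventually_gt_atTop i] with k hk
    exact min_eq_left (hσN _ _ (hk.trans_le (hφ.id_le k)))
  obtain ⟨k, hk⟩ := (hlim'.eventually (hV.mem_nhds (hNV hτ))).exists
  exact hσV _ hk

/-- Bounding the coordinates of `ℕ → ℕ` one at a time costs at most `δ k` at step `k`, by continuity
from below, and bounding all of them leaves a compact box. -/
theorem exists_isCompact_subset_range_measure_le {Z : Type*} [TopologicalSpace Z]
    [MeasurableSpace Z] (μ : Measure Z) [IsFiniteMeasure μ] [μ.OuterRegular]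
    {f : (ℕ → ℕ) → Z} (hf : Continuous f) {ε : ℝ≥0∞} (hε : ε ≠ 0) :
    ∃ K ⊆ Set.range f, IsCompact K ∧ μ (Set.range f) ≤ μ K + ε := by
  obtain ⟨δ, hδ, hδsum⟩ := ENNReal.exists_pos_sum_of_countable' hε ℕ
  have step : ∀ (C : Set (ℕ → ℕ)) (k : ℕ),
      ∃ n, μ (f '' C) ≤ μ (f '' (C ∩ {σ | σ k ≤ n})) + δ k := by
    intro C k
    have hmono : Monotone fun n => f '' (C ∩ {σ | σ k ≤ n}) := fun m n hmn =>
      Set.image_mono fun σ hσ => ⟨hσ.1, le_trans hσ.2 hmn⟩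
    have hU : f '' C = ⋃ n, f '' (C ∩ {σ | σ k ≤ n}) := by
      rw [← Set.image_iUnion, ← Set.inter_iUnion]
      congr 1
      ext σ
      simp only [Set.mem_inter_iff, Set.mem_iUnion, Set.mem_ofPred_eq]
      exact ⟨fun h => ⟨h, σ k, le_rfl⟩, fun h => h.1⟩
    have hlim := tendsto_measure_iUnion_atTop (μ := μ) hmono
    rw [← hU] at hlim
    by_cases h0 : μ (f '' C) = 0
    · exact ⟨0, by simp [h0]⟩
    have hlt : μ (f '' C) - δ k < μ (f '' C) :=
      ENNReal.sub_lt_self (measure_ne_top _ _) h0 (hδ k).ne'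
    obtain ⟨n, hn⟩ := (hlim.eventually (lt_mem_nhds hlt)).exists
    exact ⟨n, tsub_le_iff_right.1 hn.le⟩
  choose n hn using step
  let C : ℕ → Set (ℕ → ℕ) := fun k => Nat.rec Set.univ (fun j D => D ∩ {σ | σ j ≤ n D j}) k
  have hC : ∀ k, C (k + 1) = C k ∩ {σ | σ k ≤ n (C k) k} := fun k => rfl
  have hCmem : ∀ k σ, σ ∈ C k ↔ ∀ i < k, σ i ≤ n (C i) i := by
    intro k σ
    induction k with
    | zero => simp [C]
    | succ k ih =>
      rw [hC, Set.mem_inter_iff, ih, Set.mem_ofPred_eq]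
      exact ⟨fun h i hi => (Nat.lt_succ_iff_lt_or_eq.1 hi).elim (h.1 i) (fun e => e ▸ h.2),
        fun h => ⟨fun i hi => h i (by omega), h k (by omega)⟩⟩
  have hbound : ∀ k, μ (Set.range f) ≤ μ (f '' C k) + ∑ i ∈ Finset.range k, δ i := by
    intro k
    induction k with
    | zero => simp [C]
    | succ k ih =>
      refine ih.trans ?_
      rw [Finset.sum_range_succ, hC, add_comm (∑ i ∈ Finset.range k, δ i), ← add_assoc]
      gcongr
      exact hn _ _
  let K : Set (ℕ → ℕ) := {σ | ∀ i, σ i ≤ n (C i) i}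
  have hK : IsCompact K := by
    have := isCompact_univ_pi (fun i : ℕ => (Set.finite_Iic (n (C i) i)).isCompact)
    convert this using 1
    ext; simp [K, Pi.le_def]
  refine ⟨f '' K, Set.image_subset_range _ _, hK.image hf, ?_⟩
  refine ENNReal.le_of_forall_pos_le_add fun η hη _ => ?_
  -- The sets `f '' C k` need not be measurable, which rules out continuity from above. Instead, an
  -- open `U ⊇ f '' K` of almost the same measure already contains some `f '' C k`.
  obtain ⟨U, hKU, hU, hμU⟩ := (f '' K).exists_isOpen_lt_add (μ := μ) (measure_ne_top _ _)
    (ENNReal.coe_pos.2 hη).ne'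
  obtain ⟨k, hk⟩ := exists_prefix_subset_of_isOpen (fun i => n (C i) i)
    (hU.preimage hf) (Set.image_subset_iff.1 hKU)
  calc μ (Set.range f) ≤ μ (f '' C k) + ∑ i ∈ Finset.range k, δ i := hbound k
    _ ≤ (μ (f '' K) + η) + ε := by
      refine add_le_add ((measure_mono ?_).trans hμU.le) ((ENNReal.sum_le_tsum _).trans hδsum.le)
      exact Set.image_subset_iff.2 fun σ hσ => hk ((hCmem k σ).1 hσ)
    _ = μ (f '' K) + ε + η := by ring

theorem nullMeasurableSet_of_analyticSet {Z : Type*} [TopologicalSpace Z] [T2Space Z]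
    [MeasurableSpace Z] [OpensMeasurableSpace Z] (μ : Measure Z) [IsFiniteMeasure μ]
    [μ.OuterRegular] {S : Set Z} (hS : AnalyticSet S) : NullMeasurableSet S μ := by
  rw [AnalyticSet] at hS
  obtain rfl | ⟨f, hf, rfl⟩ := hS
  · exact MeasurableSet.empty.nullMeasurableSet
  have h : ∀ n : ℕ, ∃ K ⊆ Set.range f, IsCompact K ∧ μ (Set.range f) ≤ μ K + (n : ℝ≥0∞)⁻¹ :=
    fun n => exists_isCompact_subset_range_measure_le μ hf (by simp)
  choose K hKS hK hKμ using h
  have hKm : MeasurableSet (⋃ n, K n) := .iUnion fun n => (hK n).measurableSet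
  refine hKm.nullMeasurableSet.congr (ae_eq_of_subset_of_measure_ge (Set.iUnion_subset hKS) ?_
    hKm.nullMeasurableSet (measure_ne_top _ _))
  have hlim : Tendsto (fun n : ℕ => μ (⋃ n, K n) + (n : ℝ≥0∞)⁻¹) atTop (𝓝 (μ (⋃ n, K n))) := by
    simpa using ENNReal.tendsto_inv_nat_nhds_zero.const_add (μ (⋃ n, K n))
  exact ge_of_tendsto' hlim fun n =>
    (hKμ n).trans (add_le_add_left (measure_mono (Set.subset_iUnion K n)) _)

/-! ### Measurable projection and selection -/

/-- A product measurable set depends on the first coordinate only through countably many events. -/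
theorem exists_measurable_reduction {Ω E : Type*} [MeasurableSpace Ω] [MeasurableSpace E]
    {G : Set (Ω × E)} (hG : MeasurableSet G) :
    ∃ (g : Ω → ℕ → Bool) (H : Set ((ℕ → Bool) × E)), Measurable g ∧ MeasurableSet H ∧
      G = Prod.map g id ⁻¹' H := by
  classical
  induction G, hG using MeasurableSpace.induction_on_inter generateFrom_prod.symm isPiSystem_prod with
  | empty => exact ⟨fun _ _ => false, ∅, measurable_const, .empty, rfl⟩
  | basic G hG =>
    obtain ⟨A, hA, B, hB, rfl⟩ := hG
    refine ⟨fun ω _ => decide (ω ∈ A), {z | z 0 = true} ×ˢ B, ?_, ?_, ?_⟩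
    · exact measurable_pi_lambda _ fun _ => measurable_to_bool (by simpa [Set.preimage] using hA)
    · exact (measurableSet_eq_fun (measurable_pi_apply 0) measurable_const).prod hB
    · ext ⟨ω, x⟩; simp
  | compl G _ ih =>
    obtain ⟨g, H, hg, hH, rfl⟩ := ih
    exact ⟨g, Hᶜ, hg, hH.compl, rfl⟩
  | iUnion G _ _ ih =>
    choose g H hg hH hGH using ih
    -- Countably many binary sequences are interleaved into one.
    refine ⟨fun ω k => g k.unpair.1 ω k.unpair.2,
      ⋃ n, Prod.map (fun z k => z (Nat.pair n k)) id ⁻¹' H n, ?_, ?_, ?_⟩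
    · exact measurable_pi_lambda _ fun k => (measurable_pi_apply _).comp (hg _)
    · refine .iUnion fun n => (Measurable.prodMap ?_ measurable_id) (hH n)
      exact measurable_pi_lambda _ fun k => measurable_pi_apply _
    · ext ⟨ω, x⟩
      simp [hGH]

/-- The measurable projection theorem. -/
theorem measurableSet_image_fst {Ω E : Type*} [MeasurableSpace Ω] (μ : Measure Ω)
    [IsFiniteMeasure μ] [μ.IsComplete] [TopologicalSpace E] [PolishSpace E] [MeasurableSpace E]
    [BorelSpace E] {G : Set (Ω × E)} (hG : MeasurableSet G) : MeasurableSet (Prod.fst '' G) := by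
  obtain ⟨g, H, hg, hH, rfl⟩ := exists_measurable_reduction hG
  have hpre : Prod.fst '' (Prod.map g id ⁻¹' H) = g ⁻¹' (Prod.fst '' H) := by
    ext ω; simp
  rw [hpre]
  -- The projection now lives in the Cantor space, where it is analytic and so null measurable for
  -- the law of `g`.
  have hS : AnalyticSet (Prod.fst '' H) := hH.analyticSet_image measurable_fst
  exact ((nullMeasurableSet_of_analyticSet (μ.map g) hS).preimage
    (hg.quasiMeasurePreserving μ)).measurable_of_complete

/-- One refinement step towards a measurable selection. -/
theorem exists_measurable_refinement {Ω E : Type*} [MeasurableSpace Ω] (μ : Measure Ω)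
    [IsFiniteMeasure μ] [μ.IsComplete] [MetricSpace E] [PolishSpace E] [Nonempty E]
    [MeasurableSpace E] [BorelSpace E] {G : Set (Ω × E)} (hG : MeasurableSet G) {r : ℝ}
    (hr : 0 < r) :
    ∃ (G' : Set (Ω × E)) (c : Ω → E), MeasurableSet G' ∧ Measurable c ∧ G' ⊆ G ∧
      Prod.fst '' G ⊆ Prod.fst '' G' ∧ ∀ q ∈ G', dist q.2 (c q.1) ≤ r := by
  classical
  let D : ℕ → Set Ω := fun k =>
    Prod.fst '' (G ∩ {q | dist q.2 (TopologicalSpace.denseSeq E k) ≤ r})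
  have hD : ∀ k, MeasurableSet (D k) := fun k => measurableSet_image_fst μ
    (hG.inter (measurableSet_le (by fun_prop) measurable_const))
  -- The second alternative makes the least index defined everywhere.
  have hex : ∀ ω, ∃ k, ω ∈ D k ∨ ω ∉ ⋃ j, D j := fun ω => by
    by_cases h : ω ∈ ⋃ j, D j
    · exact (Set.mem_iUnion.1 h).imp fun _ => Or.inl
    · exact ⟨0, Or.inr h⟩
  let κ : Ω → ℕ := fun ω => Nat.find (hex ω)
  have hκ : Measurable κ := measurable_find hex fun k =>
    (hD k).union (MeasurableSet.iUnion hD).compl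
  let c : Ω → E := fun ω => TopologicalSpace.denseSeq E (κ ω)
  have hc : Measurable c := (measurable_from_nat (f := TopologicalSpace.denseSeq E)).comp hκ
  refine ⟨G ∩ {q | dist q.2 (c q.1) ≤ r}, c,
    hG.inter (measurableSet_le (by fun_prop) measurable_const), hc, Set.inter_subset_left, ?_,
    fun q hq => hq.2⟩
  rintro _ ⟨⟨ω, x⟩, hx, rfl⟩
  have hω : ω ∈ ⋃ j, D j := by
    obtain ⟨k, hk⟩ := (TopologicalSpace.denseRange_denseSeq E).exists_dist_lt x hr
    exact Set.mem_iUnion.2 ⟨k, ⟨ω, x⟩, ⟨hx, hk.le⟩, rfl⟩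
  obtain ⟨⟨ω', y⟩, hy, rfl⟩ := (Nat.find_spec (hex ω)).resolve_right (not_not.2 hω)
  exact ⟨(ω', y), hy, rfl⟩

/-- Measurable selection in the closures of the sections of a measurable set. -/
theorem exists_measurable_selection {Ω E : Type*} [MeasurableSpace Ω] (μ : Measure Ω)
    [IsFiniteMeasure μ] [μ.IsComplete] [MetricSpace E] [CompleteSpace E]
    [SecondCountableTopology E] [Nonempty E]
    [MeasurableSpace E] [BorelSpace E] {G : Set (Ω × E)} (hG : MeasurableSet G) :
    ∃ s : Ω → E, Measurable s ∧ ∀ q ∈ G, s q.1 ∈ closure {x | (q.1, x) ∈ G} := by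
  classical
  have step : ∀ (n : ℕ) (G : {G : Set (Ω × E) // MeasurableSet G}),
      ∃ (G' : {G : Set (Ω × E) // MeasurableSet G}) (c : Ω → E), Measurable c ∧ G'.1 ⊆ G.1 ∧
        Prod.fst '' G.1 ⊆ Prod.fst '' G'.1 ∧ ∀ q ∈ G'.1, dist q.2 (c q.1) ≤ (1 / 2) ^ n := by
    intro n G
    obtain ⟨G', c, h, h'⟩ := exists_measurable_refinement μ G.2 (r := (1 / 2) ^ n) (by positivity)
    exact ⟨⟨G', h⟩, c, h'⟩
  choose T c hc hTG hTfst hTc using step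
  let S : ℕ → {G : Set (Ω × E) // MeasurableSet G} := fun n => Nat.rec ⟨G, hG⟩ (fun j D => T j D) n
  have hS : ∀ n, S (n + 1) = T n (S n) := fun n => rfl
  have hanti : Antitone fun n => (S n).1 := antitone_nat_of_succ_le fun n => hTG n (S n)
  have hfst : ∀ n, Prod.fst '' G ⊆ Prod.fst '' (S n).1 := by
    intro n
    induction n with
    | zero => exact subset_rfl
    | succ n ih => exact ih.trans (hTfst n (S n))
  have hGm : MeasurableSet (Prod.fst '' G) := measurableSet_image_fst μ hG
  obtain ⟨e⟩ := ‹Nonempty E›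
  let d : ℕ → Ω → E := fun n => (Prod.fst '' G).piecewise (c n (S n)) fun _ => e
  have hd : ∀ n, Measurable (d n) := fun n => (hc n _).piecewise hGm measurable_const
  have hlim : ∀ ω, ∃ y, Tendsto (fun n => d n ω) atTop (𝓝 y) ∧
      ∀ x, (ω, x) ∈ G → y ∈ closure {x | (ω, x) ∈ G} := by
    intro ω
    by_cases hω : ω ∈ Prod.fst '' G
    -- `c n (S n)` is the centre for the refined set `S (n + 1)`, hence the shift.
    · have hx : ∀ n, ∃ x, (ω, x) ∈ (S (n + 1)).1 := fun n => by
        obtain ⟨⟨ω', x⟩, hx, rfl⟩ := hfst (n + 1) hω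
        exact ⟨x, hx⟩
      choose x hx using hx
      have hdn : ∀ n, d n ω = c n (S n) ω := fun n => Set.piecewise_eq_of_mem _ _ _ hω
      have hxd : ∀ n m, n ≤ m → dist (x m) (d n ω) ≤ (1 / 2) ^ n := fun n m hnm => by
        rw [hdn]
        exact hTc n (S n) (ω, x m) (hanti (by simpa using hnm : n + 1 ≤ m + 1) (hx m))
      have hcau : CauchySeq fun n => d n ω := by
        refine cauchySeq_of_le_geometric (1 / 2) 2 (by norm_num) fun n => ?_
        have h1 := hxd n (n + 1) (Nat.le_succ n)
        have h2 := hxd (n + 1) (n + 1) le_rfl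
        have h3 := dist_triangle_left (d n ω) (d (n + 1) ω) (x (n + 1))
        have h4 : (1 / 2 : ℝ) ^ (n + 1) ≤ (1 / 2) ^ n :=
          pow_le_pow_of_le_one (by norm_num) (by norm_num) (Nat.le_succ n)
        linarith
      obtain ⟨y, hy⟩ := cauchySeq_tendsto_of_complete hcau
      refine ⟨y, hy, fun _ _ => ?_⟩
      have hxy : Tendsto x atTop (𝓝 y) := by
        refine tendsto_iff_of_dist (squeeze_zero (fun _ => dist_nonneg)
          (fun n => ?_) (tendsto_pow_atTop_nhds_zero_of_lt_one (r := (1 / 2 : ℝ)) (by norm_num)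
            (by norm_num))) |>.1 hy
        rw [dist_comm]
        exact hxd n n le_rfl
      exact mem_closure_of_tendsto hxy
        (Eventually.of_forall fun n => hanti (Nat.zero_le (n + 1)) (hx n))
    · have hdn : ∀ n, d n ω = e := fun n => Set.piecewise_eq_of_notMem _ _ _ hω
      exact ⟨e, by simp only [hdn]; exact tendsto_const_nhds,
        fun x hx => absurd ⟨(ω, x), hx, rfl⟩ hω⟩
  choose s hs hsG using hlim
  exact ⟨s, measurable_of_tendsto_metrizable hd (tendsto_pi_nhds.2 hs), fun q hq => hsG q.1 q.2 hq⟩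

/-! ### Decomposable sets and strong closures -/

theorem exists_lp_piecewise {Ω E : Type*} [MeasurableSpace Ω] [NormedAddCommGroup E]
    {p : ℝ≥0∞} {μ : Measure Ω} {f g : Ω → E} {B : Set Ω} (hB : MeasurableSet B)
    (hf : MemLp (B.indicator f) p μ) (hg : MemLp g p μ) :
    ∃ η : Lp E p μ, ∀ᵐ ω ∂μ, (ω ∈ B → η ω = f ω) ∧ (ω ∉ B → η ω = g ω) := by
  refine ⟨(hf.add (hg.indicator hB.compl)).toLp _, ?_⟩
  filter_upwards [MemLp.coeFn_toLp (hf.add (hg.indicator hB.compl))] with ω hω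
  exact ⟨fun h => by simp [hω, h], fun h => by simp [hω, h]⟩

theorem IsDecomposable.exists_piecewise {Ω E : Type*} [MeasurableSpace Ω] [NormedAddCommGroup E]
    {p : ℝ≥0∞} {μ : Measure Ω} {D : Set (Lp E p μ)} (hD : IsDecomposable D) {ξ ζ : Lp E p μ}
    (hξ : ξ ∈ D) (hζ : ζ ∈ D) {B : Set Ω} (hB : MeasurableSet B) :
    ∃ η ∈ D, ∀ᵐ ω ∂μ, (ω ∈ B → η ω = ξ ω) ∧ (ω ∉ B → η ω = ζ ω) := by
  obtain ⟨η, hη⟩ := exists_lp_piecewise hB ((Lp.memLp ξ).indicator hB) (Lp.memLp ζ)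
  refine ⟨η, hD ξ hξ ζ hζ B hB η ?_, hη⟩
  filter_upwards [hη] with ω hω
  by_cases h : ω ∈ B
  · simp [h, hω.1 h]
  · simp [h, hω.2 h]

theorem isDecomposable_selections {Ω E : Type*} [MeasurableSpace Ω] [NormedAddCommGroup E]
    {p : ℝ≥0∞} {μ : Measure Ω} (X : Ω → Set E) : IsDecomposable (selections p μ X) := by
  intro ξ hξ ζ hζ B _ η hη
  filter_upwards [hξ, hζ, hη] with ω h₁ h₂ h hX
  by_cases hω : ω ∈ B
  · simpa [h, hω] using h₁ hX
  · simpa [h, hω] using h₂ hX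

theorem isDecomposable_decHull {Ω E : Type*} [MeasurableSpace Ω] [NormedAddCommGroup E]
    {p : ℝ≥0∞} {μ : Measure Ω} (A : Set (Lp E p μ)) : IsDecomposable (decHull A) :=
  fun ξ hξ ζ hζ B hB η hη D hD => hD.1 ξ (hξ D hD) ζ (hζ D hD) B hB η hη

theorem subset_decHull {Ω E : Type*} [MeasurableSpace Ω] [NormedAddCommGroup E]
    {p : ℝ≥0∞} {μ : Measure Ω} (A : Set (Lp E p μ)) : A ⊆ decHull A :=
  fun _ hξ _ hD => hD.2 hξ

theorem decHull_subset {Ω E : Type*} [MeasurableSpace Ω] [NormedAddCommGroup E]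
    {p : ℝ≥0∞} {μ : Measure Ω} {A D : Set (Lp E p μ)} (hD : IsDecomposable D) (hAD : A ⊆ D) :
    decHull A ⊆ D :=
  fun _ hξ => hξ D ⟨hD, hAD⟩

theorem TendstoLp.exists_subseq_ae {Ω E : Type*} [MeasurableSpace Ω] [NormedAddCommGroup E]
    {p : ℝ≥0∞} {μ : Measure Ω} {u : ℕ → Lp E p μ} {ξ : Lp E p μ} (h : TendstoLp u ξ) :
    ∃ φ : ℕ → ℕ, ∀ᵐ ω ∂μ, Tendsto (fun n => u (φ n) ω) atTop (𝓝 (ξ ω)) := by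
  have hm : TendstoInMeasure μ (fun n ω => u n ω) atTop (fun ω => ξ ω) := by
    unfold TendstoLp at h
    split_ifs at h with hp
    · exact h
    · exact tendstoInMeasure_of_tendsto_eLpNorm hp (fun n => Lp.aestronglyMeasurable _)
        (Lp.aestronglyMeasurable _) h
  obtain ⟨φ, -, hφ⟩ := hm.exists_seq_tendsto_ae
  exact ⟨φ, hφ⟩

theorem strongClosure_subset_selections {Ω E : Type*} [MeasurableSpace Ω] [NormedAddCommGroup E]
    {p : ℝ≥0∞} {μ : Measure Ω} {X : Ω → Set E} (hX : ∀ᵐ ω ∂μ, IsClosed (X ω))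
    {A : Set (Lp E p μ)} (hA : A ⊆ selections p μ X) : strongClosure A ⊆ selections p μ X := by
  rintro ξ ⟨u, hu, hlim⟩
  obtain ⟨φ, hφ⟩ := hlim.exists_subseq_ae
  filter_upwards [hX, hφ, ae_all_iff.2 fun n => hA (hu n)] with ω hXω hω hsel hne
  exact hXω.mem_of_tendsto hω (Eventually.of_forall fun n => hsel _ hne)

theorem subset_strongClosure {Ω E : Type*} [MeasurableSpace Ω] [NormedAddCommGroup E]
    {p : ℝ≥0∞} {μ : Measure Ω} (A : Set (Lp E p μ)) : A ⊆ strongClosure A := by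
  intro ξ hξ
  refine ⟨fun _ => ξ, fun _ => hξ, ?_⟩
  unfold TendstoLp
  split_ifs
  · intro ε hε
    simp [hε.not_ge]
  · simp

/-- Dominated convergence in `L^p(E)`, for `p ∈ {0} ∪ [1, ∞)`. -/
theorem tendstoLp_of_dominated {Ω E : Type*} [MeasurableSpace Ω] [NormedAddCommGroup E]
    {p : ℝ≥0∞} {μ : Measure Ω} [IsFiniteMeasure μ] (hp : p ≠ ∞)
    {u : ℕ → Lp E p μ} {ξ ζ : Lp E p μ} (hdom : ∀ n, ∀ᵐ ω ∂μ, ‖u n ω - ξ ω‖ ≤ ‖ζ ω‖)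
    (hlim : ∀ᵐ ω ∂μ, Tendsto (fun n => u n ω) atTop (𝓝 (ξ ω))) : TendstoLp u ξ := by
  unfold TendstoLp
  split_ifs with h0
  · exact tendstoInMeasure_of_tendsto_ae (fun n => Lp.aestronglyMeasurable _) hlim
  have hq : 0 < p.toReal := ENNReal.toReal_pos h0 hp
  have hint : Tendsto (fun n => ∫⁻ ω, ‖u n ω - ξ ω‖ₑ ^ p.toReal ∂μ) atTop
      (𝓝 (∫⁻ _, 0 ∂μ)) := by
    refine tendsto_lintegral_of_dominated_convergence (fun ω => ‖ζ ω‖ₑ ^ p.toReal)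
      (fun n => ?_) (fun n => ?_) ?_ ?_
    · exact (((Lp.stronglyMeasurable (u n)).sub (Lp.stronglyMeasurable ξ)).enorm).pow_const _
    · filter_upwards [hdom n] with ω hω
      exact ENNReal.rpow_le_rpow (enorm_le_iff_norm_le.2 hω) hq.le
    · exact (lintegral_rpow_enorm_lt_top_of_eLpNorm_lt_top h0 hp (Lp.memLp ζ).2).ne
    · filter_upwards [hlim] with ω hω
      have h1 : Tendsto (fun n => ‖u n ω - ξ ω‖ₑ) atTop (𝓝 0) := by
        simpa using (hω.sub_const (ξ ω)).enorm
      simpa [ENNReal.zero_rpow_of_pos hq] using h1.ennrpow_const p.toReal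
  simp only [eLpNorm_eq_lintegral_rpow_enorm_toReal h0 hp]
  have hr : 0 < 1 / p.toReal := by positivity
  simpa [ENNReal.zero_rpow_of_pos (inv_pos.2 hq)] using hint.ennrpow_const (1 / p.toReal)

/-! ### Decomposable sets as sets of selections -/

/-- Each new candidate is pasted in on the measurable set where it is strictly closer to `ξ`. -/
theorem IsDecomposable.exists_best_approx {Ω E : Type*} [MeasurableSpace Ω] [NormedAddCommGroup E]
    {p : ℝ≥0∞} {μ : Measure Ω} {D : Set (Lp E p μ)} (hD : IsDecomposable D)
    {u : ℕ → Lp E p μ} (hu : ∀ n, u n ∈ D) (ξ : Lp E p μ) (m : ℕ) :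
    ∃ η ∈ D, ∀ᵐ ω ∂μ, ∀ k ≤ m, ‖η ω - ξ ω‖ ≤ ‖u k ω - ξ ω‖ := by
  induction m with
  | zero => exact ⟨u 0, hu 0, Eventually.of_forall fun ω k hk => by rw [Nat.le_zero.1 hk]⟩
  | succ m ih =>
    obtain ⟨η, hη, hle⟩ := ih
    have hmeas : ∀ ζ : Lp E p μ, Measurable fun ω => ‖ζ ω - ξ ω‖ := fun ζ =>
      ((Lp.stronglyMeasurable ζ).sub (Lp.stronglyMeasurable ξ)).norm.measurable
    obtain ⟨ζ, hζ, hζω⟩ := hD.exists_piecewise hη (hu (m + 1))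
      (measurableSet_le (hmeas η) (hmeas (u (m + 1))))
    refine ⟨ζ, hζ, ?_⟩
    filter_upwards [hle, hζω] with ω h₁ h₂ k hk
    by_cases hω : ‖η ω - ξ ω‖ ≤ ‖u (m + 1) ω - ξ ω‖
    · rw [h₂.1 hω]
      exact (Nat.le_succ_iff.1 hk).elim (h₁ k) (fun e => e ▸ hω)
    · rw [h₂.2 hω]
      exact (Nat.le_succ_iff.1 hk).elim (fun h => (not_le.1 hω).le.trans (h₁ k h))
        (fun e => e ▸ le_rfl)

/-- The `u j` minimise the integral of the distance to `x`, truncated at 1 to be finite for every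
`p`. If `ξ` beat all of them by `δ` on `B`, pasting `ξ` into `u j` on `B` would gain `δ * μ B`, so
`B` is null. -/
theorem IsDecomposable.exists_minimizing_seq {Ω E : Type*} [MeasurableSpace Ω]
    [NormedAddCommGroup E] {p : ℝ≥0∞} {μ : Measure Ω} [IsProbabilityMeasure μ]
    {D : Set (Lp E p μ)} (hD : IsDecomposable D) (hne : D.Nonempty) (x : E) :
    ∃ u : ℕ → Lp E p μ, (∀ j, u j ∈ D) ∧ ∀ ξ ∈ D, ∀ δ : ℝ≥0∞, δ ≠ 0 →
      ∀ᵐ ω ∂μ, ∃ j, min 1 ‖u j ω - x‖ₑ < min 1 ‖ξ ω - x‖ₑ + δ := by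
  let φ : Lp E p μ → Ω → ℝ≥0∞ := fun ξ ω => min 1 ‖ξ ω - x‖ₑ
  have hφ : ∀ ξ, Measurable (φ ξ) := fun ξ =>
    measurable_const.min ((Lp.stronglyMeasurable ξ).sub stronglyMeasurable_const).enorm
  let J : Lp E p μ → ℝ≥0∞ := fun ξ => ∫⁻ ω, φ ξ ω ∂μ
  have hJ : ∀ ξ, J ξ ≠ ∞ := fun ξ => by
    refine (lt_of_le_of_lt (lintegral_mono fun ω => (min_le_left _ _ : φ ξ ω ≤ 1)) ?_).ne
    simp
  let α : ℝ≥0∞ := ⨅ ξ : D, J ξ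
  obtain ⟨ξ₀, hξ₀⟩ := hne
  have hα : α ≠ ∞ := ((iInf_le (fun ξ : D => J ξ) ⟨ξ₀, hξ₀⟩).trans_lt (hJ ξ₀).lt_top).ne
  have hex : ∀ j : ℕ, ∃ ξ : D, J ξ < α + (j : ℝ≥0∞)⁻¹ := fun j =>
    iInf_lt_iff.1 (ENNReal.lt_add_right hα (by simp))
  choose u hu using hex
  refine ⟨fun j => u j, fun j => (u j).2, fun ξ hξ δ hδ => ?_⟩
  let B : Set Ω := {ω | ∀ j, φ ξ ω + δ ≤ φ (u j) ω}
  have hB : MeasurableSet B := by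
    have : B = ⋂ j, {ω | φ ξ ω + δ ≤ φ (u j) ω} := by ext; simp [B]
    rw [this]
    exact .iInter fun j => measurableSet_le ((hφ ξ).add_const δ) (hφ _)
  have hbound : ∀ j : ℕ, δ * μ B ≤ (j : ℝ≥0∞)⁻¹ := fun j => by
    obtain ⟨η, hη, hηω⟩ := hD.exists_piecewise hξ (u j).2 hB
    have h1 : J η + δ * μ B ≤ J (u j) := by
      rw [← lintegral_indicator_const hB, ← lintegral_add_right _ (measurable_const.indicator hB)]
      refine lintegral_mono_ae ?_
      filter_upwards [hηω] with ω hω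
      by_cases h : ω ∈ B
      · simpa [φ, h, hω.1 h] using h j
      · simp [φ, h, hω.2 h]
    have h2 : J η + δ * μ B ≤ J η + (j : ℝ≥0∞)⁻¹ :=
      h1.trans ((hu j).le.trans (add_le_add_left (iInf_le (fun ξ : D => J ξ) ⟨η, hη⟩) _))
    exact (ENNReal.add_le_add_iff_left (hJ η)).1 h2
  have h0 : δ * μ B = 0 :=
    le_antisymm (ge_of_tendsto' ENNReal.tendsto_inv_nat_nhds_zero hbound) zero_le
  have hμB : μ B = 0 := (mul_eq_zero.1 h0).resolve_left hδ
  filter_upwards [measure_eq_zero_iff_ae_notMem.1 hμB] with ω hω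
  obtain ⟨j, hj⟩ := not_forall.1 hω
  exact ⟨j, not_le.1 hj⟩

theorem IsDecomposable.exists_dense_seq {Ω E : Type*} [MeasurableSpace Ω]
    [NormedAddCommGroup E] [TopologicalSpace.SeparableSpace E] {p : ℝ≥0∞} {μ : Measure Ω}
    [IsProbabilityMeasure μ] {D : Set (Lp E p μ)} (hD : IsDecomposable D) (hne : D.Nonempty) :
    ∃ u : ℕ → Lp E p μ, (∀ n, u n ∈ D) ∧
      ∀ ξ ∈ D, ∀ᵐ ω ∂μ, ξ ω ∈ closure (Set.range fun n => u n ω) := by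
  choose u huD hu using fun i => hD.exists_minimizing_seq hne (TopologicalSpace.denseSeq E i)
  refine ⟨fun n => u n.unpair.1 n.unpair.2, fun n => huD _ _, fun ξ hξ => ?_⟩
  have hae : ∀ᵐ ω ∂μ, ∀ i k : ℕ, ∃ j, min 1 ‖u i j ω - TopologicalSpace.denseSeq E i‖ₑ <
      min 1 ‖ξ ω - TopologicalSpace.denseSeq E i‖ₑ + (k : ℝ≥0∞)⁻¹ :=
    ae_all_iff.2 fun i => ae_all_iff.2 fun k => hu i ξ hξ _ (by simp)
  filter_upwards [hae] with ω hω
  refine EMetric.mem_closure_iff.2 fun ε hε => ?_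
  -- Capping `ε` at 1 keeps two thirds at most 1, so the truncation is inactive below.
  have hε' : min ε 1 / 3 ≠ 0 := by simp [hε.ne']
  obtain ⟨i, hi⟩ := (TopologicalSpace.denseRange_denseSeq E).exists_mem_open
    (Metric.isOpen_eball (x := ξ ω) (ε := min ε 1 / 3)) ⟨ξ ω, Metric.mem_eball_self hε'.bot_lt⟩
  have hi' : ‖ξ ω - TopologicalSpace.denseSeq E i‖ₑ < min ε 1 / 3 := by
    rwa [← edist_eq_enorm_sub, edist_comm]
  obtain ⟨k, hk⟩ := ENNReal.exists_inv_nat_lt hε'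
  obtain ⟨j, hj⟩ := hω i k
  refine ⟨u i j ω, ⟨Nat.pair i j, by simp⟩, ?_⟩
  have hthree : min ε 1 / 3 + (min ε 1 / 3 + min ε 1 / 3) = min ε 1 := by
    rw [← add_assoc, ENNReal.add_thirds]
  have hlt : min 1 ‖u i j ω - TopologicalSpace.denseSeq E i‖ₑ < min ε 1 / 3 + min ε 1 / 3 :=
    hj.trans_le (add_le_add ((min_le_right _ _).trans hi'.le) hk.le)
  have htwo : min ε 1 / 3 + min ε 1 / 3 ≤ 1 :=
    (le_add_self.trans hthree.le).trans (min_le_right _ _)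
  have hlt' := (min_lt_iff.1 hlt).resolve_left (not_lt.2 htwo)
  calc edist (ξ ω) (u i j ω)
      ≤ edist (ξ ω) (TopologicalSpace.denseSeq E i) +
        edist (u i j ω) (TopologicalSpace.denseSeq E i) := edist_triangle_right _ _ _
    _ < min ε 1 / 3 + (min ε 1 / 3 + min ε 1 / 3) := by
      simp only [edist_eq_enorm_sub]
      exact ENNReal.add_lt_add hi' hlt'
    _ ≤ ε := hthree.le.trans (min_le_left _ _)

/-- The strong closure of a decomposable set consists of the selections of a closed random set
(Hiai and Umegaki). -/
theorem IsDecomposable.exists_strongClosure_eq_selections {Ω E : Type*} [MeasurableSpace Ω]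
    [NormedAddCommGroup E] [TopologicalSpace.SeparableSpace E] [MeasurableSpace E] [BorelSpace E]
    {p : ℝ≥0∞} (hp : p ≠ ∞) {μ : Measure Ω}
    [IsProbabilityMeasure μ] {D : Set (Lp E p μ)} (hD : IsDecomposable D) (hne : D.Nonempty) :
    ∃ u : ℕ → Lp E p μ, (∀ n, u n ∈ D) ∧
      strongClosure D = selections p μ fun ω => closure (Set.range fun n => u n ω) := by
  obtain ⟨u, huD, hu⟩ := hD.exists_dense_seq hne
  refine ⟨u, huD, subset_antisymm ?_ fun ξ hξ => ?_⟩
  · refine strongClosure_subset_selections (Eventually.of_forall fun _ => isClosed_closure) ?_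
    intro ξ hξ
    filter_upwards [hu ξ hξ] with ω hω _ using hω
  -- The best approximations to `ξ` among `u 0, …, u n` converge pointwise, dominated by the error
  -- of `u 0`.
  · choose η hηD hη using hD.exists_best_approx huD ξ
    refine ⟨η, hηD, tendstoLp_of_dominated hp (ζ := u 0 - ξ) (fun n => ?_) ?_⟩
    · filter_upwards [hη n, Lp.coeFn_sub (u 0) ξ] with ω h₁ h₂
      rw [h₂]
      exact h₁ 0 (Nat.zero_le n)
    · filter_upwards [hξ, ae_all_iff.2 hη] with ω h₁ h₂
      refine Metric.tendsto_atTop.2 fun ε hε => ?_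
      obtain ⟨_, ⟨k, rfl⟩, hk⟩ := Metric.mem_closure_iff.1
        (h₁ ⟨_, subset_closure ⟨0, rfl⟩⟩) ε hε
      refine ⟨k, fun n hn => ?_⟩
      rw [dist_eq_norm]
      refine (h₂ n k hn).trans_lt ?_
      rwa [← dist_eq_norm, dist_comm]

theorem isClosedRandomSet_closure_range {Ω E : Type*} [MeasurableSpace Ω]
    [NormedAddCommGroup E] [TopologicalSpace.SeparableSpace E] [MeasurableSpace E] [BorelSpace E]
    {p : ℝ≥0∞} {μ : Measure Ω} (u : ℕ → Lp E p μ) :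
    IsClosedRandomSet μ fun ω => closure (Set.range fun n => u n ω) := by
  have := UniformSpace.secondCountable_of_separable E
  refine ⟨?_, Eventually.of_forall fun _ => isClosed_closure⟩
  have hset : {q : Ω × E | q.2 ∈ closure (Set.range fun n => u n q.1)} =
      ⋂ k : ℕ, ⋃ n, {q | dist q.2 (u n q.1) < 1 / (k + 1)} := by
    ext q
    simp only [Set.mem_ofPred_eq, Metric.mem_closure_range_iff, Set.mem_iInter, Set.mem_iUnion]
    refine ⟨fun h k => h _ Nat.one_div_pos_of_nat, fun h ε hε => ?_⟩
    obtain ⟨k, hk⟩ := exists_nat_one_div_lt hε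
    exact (h k).imp fun n hn => hn.trans hk
  have hu : ∀ n, Measurable (u n) := fun n => (Lp.stronglyMeasurable (u n)).measurable
  rw [IsRandomSet, hset]
  exact .iInter fun k => .iUnion fun n => measurableSet_lt
    (measurable_snd.dist ((hu n).comp measurable_fst)) measurable_const

/-- If `F` has a selection in `L^p(E)`, inclusion of the sets of selections gives almost sure
inclusion of the random sets. -/
theorem ae_subset_of_selections_subset {Ω E : Type*} [MeasurableSpace Ω]
    [NormedAddCommGroup E] [CompleteSpace E] [TopologicalSpace.SeparableSpace E]
    [MeasurableSpace E] [BorelSpace E] {p : ℝ≥0∞} {μ : Measure Ω} [IsFiniteMeasure μ]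
    [μ.IsComplete] {F X : Ω → Set E} (hF : IsClosedRandomSet μ F) (hX : ∀ᵐ ω ∂μ, IsClosed (X ω))
    (hne : (selections p μ F).Nonempty) (hFX : selections p μ F ⊆ selections p μ X) :
    ∀ᵐ ω ∂μ, (X ω).Nonempty → F ω ⊆ X ω := by
  have := UniformSpace.secondCountable_of_separable E
  obtain ⟨ξ, hξ⟩ := hne
  let c := TopologicalSpace.denseSeq E
  -- Closed balls keep the sections closed, so selections from their closures stay in `F`.
  let G : ℕ → ℕ → Set (Ω × E) := fun i k =>
    {q | q.2 ∈ F q.1} ∩ {q | dist q.2 (c i) ≤ 1 / (k + 1)}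
  have hG : ∀ i k, MeasurableSet (G i k) := fun i k =>
    MeasurableSet.inter hF.1 (measurableSet_le (measurable_snd.dist measurable_const)
      measurable_const)
  choose s hs hsG using fun i k => exists_measurable_selection μ (hG i k)
  -- On `B` the selection is bounded; replacing it by `ξ` elsewhere gives an element of `L^p(F)`.
  let B : ℕ → ℕ → ℕ → Set Ω := fun i k n => Prod.fst '' G i k ∩ {ω | ‖s i k ω‖ ≤ n}
  have hB : ∀ i k n, MeasurableSet (B i k n) := fun i k n =>
    (measurableSet_image_fst μ (hG i k)).inter (measurableSet_le (hs i k).norm measurable_const)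
  have hmem : ∀ i k n, MemLp ((B i k n).indicator (s i k)) p μ := fun i k n => by
    refine MemLp.of_bound ((hs i k).indicator (hB i k n)).aestronglyMeasurable n
      (Eventually.of_forall fun ω => ?_)
    by_cases hω : ω ∈ B i k n
    · simpa [hω] using hω.2
    · simp [hω]
  choose η hη using fun i k n => exists_lp_piecewise (hB i k n) (hmem i k n) (Lp.memLp ξ)
  have hsec : ∀ i k, ∀ ω, IsClosed (F ω) → ω ∈ Prod.fst '' G i k →
      s i k ω ∈ F ω ∧ dist (s i k ω) (c i) ≤ 1 / (k + 1) := by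
    rintro i k _ hω ⟨⟨ω, x⟩, hx, rfl⟩
    have hcl : IsClosed {x | (ω, x) ∈ G i k} :=
      hω.inter (isClosed_le (continuous_id.dist continuous_const) continuous_const)
    exact hcl.closure_subset (hsG i k _ hx)
  have hηF : ∀ i k n, η i k n ∈ selections p μ F := fun i k n => by
    filter_upwards [hη i k n, hξ, hF.2] with ω h₁ h₂ h₃ h₄
    by_cases hω : ω ∈ B i k n
    · rw [h₁.1 hω]
      exact (hsec i k ω h₃ hω.1).1
    · rw [h₁.2 hω]
      exact h₂ h₄
  filter_upwards [hX, hF.2, ae_all_iff.2 fun i => ae_all_iff.2 fun k => ae_all_iff.2 fun n =>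
    (hη i k n).and (hFX (hηF i k n))] with ω hXω hFω hω hXne x hx
  refine hXω.closure_subset (Metric.mem_closure_iff.2 fun ε hε => ?_)
  obtain ⟨k, hk⟩ := exists_nat_one_div_lt (half_pos hε)
  obtain ⟨i, hi⟩ := (TopologicalSpace.denseRange_denseSeq E).exists_dist_lt x
    (Nat.one_div_pos_of_nat (α := ℝ) (n := k))
  obtain ⟨n, hn⟩ := exists_nat_ge ‖s i k ω‖
  have hωG : ω ∈ Prod.fst '' G i k := ⟨(ω, x), ⟨hx, hi.le⟩, rfl⟩
  obtain ⟨h₁, h₂⟩ := hω i k n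
  rw [h₁.1 ⟨hωG, hn⟩] at h₂
  refine ⟨s i k ω, h₂ hXne, ?_⟩
  have h₃ := (hsec i k ω hFω hωG).2
  have h₄ := dist_triangle_right x (s i k ω) (c i)
  change dist x (c i) < _ at hi
  linarith

/-! ### Barycenters -/

/-- A functional strictly separating `y` from `C` would have `ν`-mean strictly below its value at
`y`. -/
theorem IsBarycenter.mem_of_convex {E : Type*} [NormedAddCommGroup E] [NormedSpace ℝ E]
    [MeasurableSpace E] {ν : Measure E} [IsProbabilityMeasure ν] {y : E} (h : IsBarycenter ν y)
    {C : Set E} (hconv : Convex ℝ C) (hcl : IsClosed C) (hC : ∀ᵐ x ∂ν, x ∈ C) : y ∈ C := by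
  by_contra hy
  obtain ⟨L, a, hLa, hay⟩ := geometric_hahn_banach_closed_point hconv hcl hy
  have hle : ∫ x, L x ∂ν ≤ ∫ _, a ∂ν :=
    integral_mono_ae (h L).1 (integrable_const a) (hC.mono fun x hx => (hLa x hx).le)
  rw [← (h L).2] at hle
  simp at hle
  exact absurd hle hay.not_ge

/-- The kernel charging two random points with complementary weights. -/
noncomputable def twoPointKernel {Ω E : Type*} [MeasurableSpace Ω] [MeasurableSpace E]
    {f g : Ω → E} (hf : Measurable f) (hg : Measurable g) (t : unitInterval) : Kernel Ω E where
  toFun ω := ENNReal.ofReal (1 - t) • Measure.dirac (f ω) + ENNReal.ofReal t • Measure.dirac (g ω)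
  measurable' := Measure.measurable_of_measurable_coe _ fun S hS => by
    simp only [Measure.add_apply, Measure.smul_apply, smul_eq_mul]
    exact (((Measure.measurable_coe hS).comp (Measure.measurable_dirac.comp hf)).const_mul _).add
      (((Measure.measurable_coe hS).comp (Measure.measurable_dirac.comp hg)).const_mul _)

theorem twoPointKernel_apply_eq_one {Ω E : Type*} [MeasurableSpace Ω] [MeasurableSpace E]
    {f g : Ω → E} (hf : Measurable f) (hg : Measurable g) (t : unitInterval) {ω : Ω} {S : Set E}
    (hfS : f ω ∈ S) (hgS : g ω ∈ S) : twoPointKernel hf hg t ω S = 1 := by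
  change (ENNReal.ofReal (1 - t) • Measure.dirac (f ω) +
    ENNReal.ofReal t • Measure.dirac (g ω)) S = 1
  rw [Measure.add_apply, Measure.smul_apply, Measure.smul_apply, Measure.dirac_apply_of_mem hfS,
    Measure.dirac_apply_of_mem hgS, smul_eq_mul, smul_eq_mul, mul_one, mul_one,
    ← ENNReal.ofReal_add (sub_nonneg.2 t.2.2) t.2.1, sub_add_cancel, ENNReal.ofReal_one]

theorem isBarycenter_twoPointKernel {Ω E : Type*} [MeasurableSpace Ω] [NormedAddCommGroup E]
    [NormedSpace ℝ E] [MeasurableSpace E] [BorelSpace E]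
    {f g : Ω → E} (hf : Measurable f) (hg : Measurable g) (t : unitInterval) (ω : Ω) :
    IsBarycenter (twoPointKernel hf hg t ω) ((1 - t : ℝ) • f ω + (t : ℝ) • g ω) := by
  intro L
  change Integrable _ (ENNReal.ofReal (1 - t) • Measure.dirac (f ω) +
    ENNReal.ofReal t • Measure.dirac (g ω)) ∧ _ = ∫ x, L x ∂(ENNReal.ofReal (1 - t) •
      Measure.dirac (f ω) + ENNReal.ofReal t • Measure.dirac (g ω))
  have h₁ : Integrable (fun x => L x) (ENNReal.ofReal (1 - t) • Measure.dirac (f ω)) :=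
    (integrable_dirac enorm_lt_top).smul_measure ENNReal.ofReal_ne_top
  have h₂ : Integrable (fun x => L x) (ENNReal.ofReal t • Measure.dirac (g ω)) :=
    (integrable_dirac enorm_lt_top).smul_measure ENNReal.ofReal_ne_top
  refine ⟨h₁.add_measure h₂, ?_⟩
  rw [integral_add_measure h₁ h₂, integral_smul_measure, integral_smul_measure, integral_dirac,
    integral_dirac, ENNReal.toReal_ofReal (sub_nonneg.2 t.2.2), ENNReal.toReal_ofReal t.2.1,
    map_add, map_smul, map_smul]

/-- The endpoints range over all selections of `F`, not just over `A`, so `t = 0` already gives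
`selections p μ F ⊆ A`. -/
theorem IsChoquetConvexDecomposable.segment_mem {Ω E : Type*} [MeasurableSpace Ω]
    [NormedAddCommGroup E] [NormedSpace ℝ E] [TopologicalSpace.SeparableSpace E]
    [MeasurableSpace E] [BorelSpace E] {p : ℝ≥0∞} {μ : Measure Ω} {A : Set (Lp E p μ)}
    (hA : IsChoquetConvexDecomposable A) {F : Ω → Set E} (hF : IsDecHullRandomSet A F)
    {ξ ζ : Lp E p μ} (hξ : ξ ∈ selections p μ F) (hζ : ζ ∈ selections p μ F) (t : unitInterval) :
    (1 - t : ℝ) • ξ + (t : ℝ) • ζ ∈ A := by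
  have hξm : Measurable ξ := (Lp.stronglyMeasurable ξ).measurable
  have hζm : Measurable ζ := (Lp.stronglyMeasurable ζ).measurable
  refine hA _ ⟨F, hF, twoPointKernel hξm hζm t,
    ⟨fun ω => ⟨twoPointKernel_apply_eq_one _ _ _ trivial trivial⟩⟩, ?_, ?_⟩
  · filter_upwards [hξ, hζ, hF.2.1] with ω h₁ h₂ h₃
    exact twoPointKernel_apply_eq_one _ _ _ (h₁ h₃) (h₂ h₃)
  · filter_upwards [Lp.coeFn_add ((1 - t : ℝ) • ξ) ((t : ℝ) • ζ), Lp.coeFn_smul (1 - t : ℝ) ξ,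
      Lp.coeFn_smul (t : ℝ) ζ] with ω h₁ h₂ h₃
    rw [h₁, Pi.add_apply, h₂, h₃]
    exact isBarycenter_twoPointKernel _ _ _ _

/-- Combinations are continuous in the weight and in the endpoints, so dense families of both
suffice. With countable families, the exceptional null sets can be united. -/
theorem convex_closure_of_countable_segments {E ι : Type*} [NormedAddCommGroup E]
    [NormedSpace ℝ E] {a : ι → E} {τ : ι → unitInterval} (hτ : DenseRange τ)
    (h : ∀ i k l, (1 - τ i : ℝ) • a k + (τ i : ℝ) • a l ∈ closure (Set.range a)) :
    Convex ℝ (closure (Set.range a)) := by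
  have h₁ : ∀ (t : unitInterval) k l, (1 - t : ℝ) • a k + (t : ℝ) • a l ∈ closure (Set.range a) :=
    fun t k l => isClosed_property hτ (isClosed_closure.preimage
      (f := fun s : unitInterval => (1 - s : ℝ) • a k + (s : ℝ) • a l) (by fun_prop)) (h · k l) t
  rw [convex_iff_forall_pos]
  intro x hx y hy s t hs ht hst
  obtain rfl : s = 1 - t := by linarith
  refine isClosed_closure.closure_subset
    (map_mem_closure₂ (f := fun x y => (1 - t) • x + t • y) (by fun_prop) hx hy ?_)
  rintro _ ⟨k, rfl⟩ _ ⟨l, rfl⟩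
  exact h₁ ⟨t, ht.le, by linarith⟩ k l

/-! ### Choquet convex decomposable sets -/

theorem isChoquetConvexDecomposable_selections {Ω E : Type*} [MeasurableSpace Ω]
    [NormedAddCommGroup E] [NormedSpace ℝ E] [CompleteSpace E]
    [TopologicalSpace.SeparableSpace E] [MeasurableSpace E] [BorelSpace E] {p : ℝ≥0∞}
    {μ : Measure Ω} [IsFiniteMeasure μ] [μ.IsComplete] {X : Ω → Set E}
    (hX : IsClosedConvexRandomSet μ X) (hne : (selections p μ X).Nonempty) :
    IsChoquetConvexDecomposable (selections p μ X) := by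
  rintro Y ⟨F, ⟨hF, -, hsel⟩, K, hK, hKF, hKY⟩
  -- `selections p μ X` is itself decomposable and strongly closed.
  have hsub : selections p μ F ⊆ selections p μ X := hsel ▸
    strongClosure_subset_selections hX.1.2 (decHull_subset (isDecomposable_selections X) le_rfl)
  have hne' : (selections p μ F).Nonempty := hsel ▸
    hne.mono ((subset_decHull _).trans (subset_strongClosure _))
  filter_upwards [hX.1.2, hX.2, ae_subset_of_selections_subset hF hX.1.2 hne' hsub, hKF, hKY]
    with ω hcl hconv hFX hKω hY hXne
  refine hY.mem_of_convex hconv hcl ?_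
  have h1 : K ω (X ω) = 1 :=
    le_antisymm prob_le_one (hKω ▸ measure_mono (hFX hXne))
  exact (prob_compl_eq_zero_iff hcl.measurableSet).2 h1

theorem IsChoquetConvexDecomposable.exists_eq_selections {Ω E : Type*} [MeasurableSpace Ω]
    [NormedAddCommGroup E] [NormedSpace ℝ E] [TopologicalSpace.SeparableSpace E]
    [MeasurableSpace E] [BorelSpace E] {p : ℝ≥0∞} (hp : p ≠ ∞) {μ : Measure Ω}
    [IsProbabilityMeasure μ] {A : Set (Lp E p μ)} (hA : IsChoquetConvexDecomposable A)
    (hne : A.Nonempty) :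
    ∃ X : Ω → Set E, IsClosedConvexRandomSet μ X ∧ IsNonemptyValued μ X ∧
      A = selections p μ X := by
  obtain ⟨u, -, hu⟩ := (isDecomposable_decHull A).exists_strongClosure_eq_selections hp
    (hne.mono (subset_decHull A))
  have hF : IsDecHullRandomSet A fun ω => closure (Set.range fun n => u n ω) :=
    ⟨isClosedRandomSet_closure_range u,
      Eventually.of_forall fun ω => ⟨u 0 ω, subset_closure ⟨0, rfl⟩⟩, hu⟩
  have heq : A = selections p μ fun ω => closure (Set.range fun n => u n ω) :=
    subset_antisymm (hu ▸ (subset_decHull A).trans (subset_strongClosure _)) fun ξ hξ => by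
      simpa using hA.segment_mem hF hξ hξ 0
  refine ⟨fun ω => closure (Set.range fun n => u n ω), ⟨hF.1, ?_⟩, hF.2.1, heq⟩
  have hsel : ∀ n, u n ∈ selections p μ fun ω => closure (Set.range fun n => u n ω) := by
    intro n
    have h : ∀ᵐ ω ∂μ, (closure (Set.range fun m => u m ω)).Nonempty →
        u n ω ∈ closure (Set.range fun m => u m ω) :=
      Eventually.of_forall fun ω _ => subset_closure (Set.mem_range_self n)
    exact h
  let τ := TopologicalSpace.denseSeq unitInterval
  have hseg : ∀ i k l, ∀ᵐ ω ∂μ, (1 - τ i : ℝ) • u k ω + (τ i : ℝ) • u l ω ∈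
      closure (Set.range fun n => u n ω) := fun i k l => by
    have hmem := hA.segment_mem hF (hsel k) (hsel l) (τ i)
    rw [heq] at hmem
    filter_upwards [hmem, hF.2.1, Lp.coeFn_add ((1 - τ i : ℝ) • u k) ((τ i : ℝ) • u l),
      Lp.coeFn_smul (1 - τ i : ℝ) (u k), Lp.coeFn_smul (τ i : ℝ) (u l)] with ω h₁ h₂ h₃ h₄ h₅
    have h₆ := h₁ h₂
    rwa [h₃, Pi.add_apply, h₄, h₅] at h₆
  filter_upwards [ae_all_iff.2 fun i => ae_all_iff.2 fun k => ae_all_iff.2 fun l => hseg i k l]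
    with ω hω
  exact convex_closure_of_countable_segments (TopologicalSpace.denseRange_denseSeq _) hω

end RandomSets

theorem proposition7p3 {Ω E : Type*} [MeasurableSpace Ω]
    [NormedAddCommGroup E] [NormedSpace ℝ E] [CompleteSpace E]
    [TopologicalSpace.SeparableSpace E] [MeasurableSpace E] [BorelSpace E]
    (μ : Measure Ω) [IsProbabilityMeasure μ] [μ.IsComplete]
    (p : ℝ≥0∞) (hp : p = 0 ∨ (1 ≤ p ∧ p ≠ ∞))
    (A : Set (Lp E p μ)) (hA : A.Nonempty) :
    (RandomSets.IsChoquetConvexDecomposable A ↔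
      ∃ X : Ω → Set E, RandomSets.IsClosedConvexRandomSet μ X ∧
        A = RandomSets.selections p μ X) ∧
    (RandomSets.IsChoquetConvexDecomposable A →
      ∃ X : Ω → Set E, RandomSets.IsClosedConvexRandomSet μ X ∧
        RandomSets.IsNonemptyValued μ X ∧
        A = RandomSets.selections p μ X ∧
        ∀ Y : Ω → Set E, RandomSets.IsClosedConvexRandomSet μ Y →
          RandomSets.IsNonemptyValued μ Y → A = RandomSets.selections p μ Y →
          ∀ᵐ ω ∂μ, Y ω = X ω) := by
  have hp' : p ≠ ∞ := by
    rintro rfl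
    simp at hp
  refine ⟨⟨fun h => ?_, ?_⟩, fun h => ?_⟩
  · obtain ⟨X, hX, -, hAX⟩ := h.exists_eq_selections hp' hA
    exact ⟨X, hX, hAX⟩
  · rintro ⟨X, hX, rfl⟩
    exact RandomSets.isChoquetConvexDecomposable_selections hX hA
  · obtain ⟨X, hX, hXne, hAX⟩ := h.exists_eq_selections hp' hA
    refine ⟨X, hX, hXne, hAX, fun Y hY hYne hAY => ?_⟩
    have hXY : RandomSets.selections p μ X = RandomSets.selections p μ Y := hAX.symm.trans hAY
    -- Nonempty values remove the proviso in the two almost sure inclusions.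
    filter_upwards [hXne, hYne,
      RandomSets.ae_subset_of_selections_subset hX.1 hY.1.2 (hAX ▸ hA) hXY.le,
      RandomSets.ae_subset_of_selections_subset hY.1 hX.1.2 (hAY ▸ hA) hXY.ge] with ω h₁ h₂ h₃ h₄
    exact (h₄ h₁).antisymm (h₃ h₂)
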